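/- Let $K\ge 1$. A $K$-armed budgeted bandit consists of integrable real random pairs $(X_{n,k},R_{n,k})$, $n\ge 1$, $1\le k\le K$ (cost and reward of arm $k$ in epoch $n$), which are independent over all $(n,k)$ and, for each $k$, identically distributed over $n$; $X_{n,k}$ and $R_{n,k}$ may be dependent, and costs may be negative. Assume that $\mathbb{E}[X_{1,k}]>0$ for all $k$ and that for some $\gamma>0$ one has $\mathbb{E}[(X_{1,k}^+)^{2+\gamma}]<\infty$ for all $k$. A policy $\pi$ is a sequence of random arms $I_n^\pi\in\{1,\dots,K\}$, $n\ge1$; it is admissible if $\{I_n^\pi=k\}\in\mathcal{F}_{n-1}^\pi$ for all $n,k$, where $\mathcal{F}_n^\pi$ is the $\sigma$-field generated by the observed pairs $(X_{j,I_j^\pi},R_{j,I_j^\pi})$, $1\le j\le n$. For a budget $B>0$ let $S_n^\pi=\sum_{i=1}^nX_{i,I_i^\pi}$, $N_\pi(B)=\inf\{n:S_n^\pi>B\}$ and $\mathrm{REW}_\pi(B)=\sum_{i=1}^{N_\pi(B)}R_{i,I_i^\pi}$. Let $r_k=\mathbb{E}[R_{1,k}]/\mathbb{E}[X_{1,k}]$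 and $r^*=\max_kr_k$, let $k^*$ be any arm with $r_{k^*}=r^*$, and let $\pi^*$ be the static policy that always pulls $k^*$. Then for every admissible $\pi$ and every $B>0$ the number $N_\pi(B)$ is almost surely finite and $\mathrm{REW}_\pi(B)$ is integrable; $\pi^*$ is admissible; and there is a constant $G^\star<\infty$, independent of $B$ and of $\pi$, such that $$\mathbb{E}[\mathrm{REW}_\pi(B)]-\mathbb{E}[\mathrm{REW}_{\pi^*}(B)]\le G^\star\qquad\text{for all } B>0 \text{ and all admissible } \pi.$$ If moreover all costs have finite variance, one can take $$G^\star=|r^*|\cdot G\Big(K,\ \min_k\mathbb{E}[X_{1,k}],\ \max_k\mathbb{E}[X_{1,k}],\ \max_k\mathrm{Var}(X_{1,k})\Big)$$ with a function $G$ that is the same for all bandits. Consequently $\pi^*$ is asymptotically optimal: with $\mathrm{OPT}(B)=\sup_{\pi}\mathbb{E}[\mathrm{REW}_\pi(B)]$, the supremum over admissible policies, $(\mathrm{OPT}(B)-\mathbb{E}[\mathrm{REW}_{\pi^*}(B)])/B\to0$ as $B\to\infty$, and if $r^*\ne0$, then $\mathbb{E}[\mathrm{REW}_{\pi^*}(B)]/\mathrm{OPT}(B)\to1$.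 -/

import Mathlib

open MeasureTheory ProbabilityTheory Filter Topology

/-- A stochastic bandit with `K` arms and random costs, on a probability space `(Ω, P)`.
Epochs are numbered from `0`: `X n k` and `R n k` are the cost and the reward of arm `k` in the
`(n+1)`-st epoch. The pairs are independent over epochs and arms, and for each arm identically
distributed over the epochs; cost and reward of one pull may be dependent. Costs may be negative,
but have positive mean. -/
structure BudgetedBandit (K : ℕ) {Ω : Type*} [MeasurableSpace Ω] (P : Measure Ω) where
  /-- costs -/
  X : ℕ → Fin K → Ω → ℝ
  /-- rewards -/
  R : ℕ → Fin K → Ω → ℝ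
  measurable_X : ∀ n k, Measurable (X n k)
  measurable_R : ∀ n k, Measurable (R n k)
  indep : iIndepFun (fun (p : ℕ × Fin K) (ω : Ω) => (X p.1 p.2 ω, R p.1 p.2 ω)) P
  identDistrib : ∀ n k, IdentDistrib (fun ω => (X n k ω, R n k ω)) (fun ω => (X 0 k ω, R 0 k ω)) P P
  integrable_X : ∀ k, Integrable (X 0 k) P
  integrable_R : ∀ k, Integrable (R 0 k) P
  mean_pos : ∀ k, 0 < ∫ ω, X 0 k ω ∂P

namespace BudgetedBandit

variable {K : ℕ} {Ω : Type*} [MeasurableSpace Ω] {P : Measure Ω}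

/-- There is `γ > 0` such that the positive part of every cost has a finite `(2+γ)`-th moment. -/
def MomentCondition (𝔟 : BudgetedBandit K P) : Prop :=
  ∃ γ : ℝ, 0 < γ ∧ ∀ k, Integrable (fun ω => (max (𝔟.X 0 k ω) 0) ^ (2 + γ)) P

/-- All costs have finite variance. -/
def FiniteVariance (𝔟 : BudgetedBandit K P) : Prop :=
  ∀ k, MemLp (𝔟.X 0 k) 2 P

/-- Mean cost of arm `k`. -/
noncomputable def meanCost (𝔟 : BudgetedBandit K P) (k : Fin K) : ℝ := ∫ ω, 𝔟.X 0 k ω ∂P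

/-- Variance of the cost of arm `k`. -/
noncomputable def varCost (𝔟 : BudgetedBandit K P) (k : Fin K) : ℝ := variance (𝔟.X 0 k) P

/-- Reward rate `r_k = E[R_{1,k}] / E[X_{1,k}]`. -/
noncomputable def rewardRate (𝔟 : BudgetedBandit K P) (k : Fin K) : ℝ :=
  (∫ ω, 𝔟.R 0 k ω ∂P) / ∫ ω, 𝔟.X 0 k ω ∂P

/-- The history of the first `n` epochs, when the arm `I j` is pulled in epoch `j`: the σ-algebra
generated by the observed cost-reward pairs. -/
@[reducible] def history (𝔟 : BudgetedBandit K P) (I : ℕ → Ω → Fin K) (n : ℕ) : MeasurableSpace Ω :=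
  ⨆ (j : ℕ) (_ : j < n),
    MeasurableSpace.comap (fun ω => (𝔟.X j (I j ω) ω, 𝔟.R j (I j ω) ω))
      (inferInstance : MeasurableSpace (ℝ × ℝ))

/-- A policy, i.e. a sequence of random arms, is admissible if it is non-anticipating: the arm
pulled after `n` epochs is determined by the history of these `n` epochs. -/
def Admissible (𝔟 : BudgetedBandit K P) (I : ℕ → Ω → Fin K) : Prop :=
  ∀ n k, MeasurableSet[𝔟.history I n] {ω | I n ω = k}

/-- Total cost `S_n` of the first `n` epochs. -/
noncomputable def totalCost (𝔟 : BudgetedBandit K P) (I : ℕ → Ω → Fin K) (n : ℕ) (ω : Ω) : ℝ :=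
  ∑ i ∈ Finset.range n, 𝔟.X i (I i ω) ω

/-- Number of pulls `N(B) = inf {n : S_n > B}` (`⊤` if the budget is never depleted). -/
noncomputable def pulls (𝔟 : BudgetedBandit K P) (I : ℕ → Ω → Fin K) (B : ℝ) (ω : Ω) : ℕ∞ :=
  ⨅ (n : ℕ) (_ : B < 𝔟.totalCost I n ω), (n : ℕ∞)

/-- Cumulative reward up to and including the epoch in which the budget `B` is depleted
(an arbitrary value where the budget is never depleted). -/
noncomputable def reward (𝔟 : BudgetedBandit K P) (I : ℕ → Ω → Fin K) (B : ℝ) (ω : Ω) : ℝ :=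
  ∑ i ∈ Finset.range (𝔟.pulls I B ω).toNat, 𝔟.R i (I i ω) ω

/-- Expected cumulative reward. -/
noncomputable def expReward (𝔟 : BudgetedBandit K P) (I : ℕ → Ω → Fin K) (B : ℝ) : ℝ :=
  ∫ ω, 𝔟.reward I B ω ∂P

/-- The static policy that always pulls arm `k`. -/
def staticPolicy (_𝔟 : BudgetedBandit K P) (k : Fin K) : ℕ → Ω → Fin K := fun _ _ => k

/-- Optimal expected cumulative reward over all admissible policies. -/
noncomputable def optReward (𝔟 : BudgetedBandit K P) (B : ℝ) : ℝ :=
  sSup {v : ℝ | ∃ I : ℕ → Ω → Fin K, 𝔟.Admissible I ∧ v = 𝔟.expReward I B}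

end BudgetedBandit

/-! An admissible choice is determined by the past, hence independent of the current pairs. By
Wald's identity the expected reward is therefore the sum over epochs and arms of P(arm k is pulled
within the budget) · r_k · E[X_k]. If T(π) is the expected total cost up to depletion, then E[REW_π]
≤ r* T(π), with equality for π*. Since S_N > B, also T(π) ≥ B. What remains is T(π) ≤ B + C with C
independent of B and π, that is, a uniform bound on the mean overshoot; the gap is then at most |r*|
C.

The overshoot is bounded by a potential of the remaining budget z. Let m be a lower bound for the
means, M an upper bound for the E[(X_k⁺)²], s(z) = ∑_k E[(X_k - z)⁺] and L = M/(2m). The potential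
is z⁻ + h(z), where h has slope (2/m) s(z) on [0, ∞) and (2/m) s(0) on [-L, 0], and vanishes below
-L. As s integrates to ∑_k E[(X_k⁺)²]/2, h is bounded. As s decreases, h is concave on [-L, ∞), so
pulling arm k at z ≥ 0 lowers h on average by at least (2/m) s(z) E[min(X_k, L)] ≥ s(z). This pays
for the mean overshoot E[(X_k - z)⁺] ≤ s(z) of that pull. The potential is thus a supermartingale up
to depletion, whatever the policy, and the mean overshoot is at most h(B).

The key lemmas are `lintegral_potential_le`, `Admissible.lintegral_stoppedCost_le`,
`Admissible.sum_meanSpending_le` and `Admissible.hasSum_wald`. -/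

section Potential

/-! ### Excess moments of a single cost -/

variable {ι Ω : Type*} [Fintype ι] [MeasurableSpace Ω] {P : Measure Ω}

/-- Mean excess `E[(x - y)⁺]` of a random variable over a level. -/
noncomputable def meanExcess (P : Measure Ω) (x : Ω → ℝ) (y : ℝ) : ℝ := ∫ ω, max (x ω - y) 0 ∂P

/-- Mean squared excess `E[((x - y)⁺)²]` of a random variable over a level. -/
noncomputable def sqExcess (P : Measure Ω) (x : Ω → ℝ) (y : ℝ) : ℝ := ∫ ω, max (x ω - y) 0 ^ 2 ∂P

lemma integrable_excess [IsFiniteMeasure P] {x : Ω → ℝ} (hx : Integrable x P) (y : ℝ) :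
    Integrable (fun ω => max (x ω - y) 0) P :=
  (hx.sub (integrable_const y)).pos_part

lemma integrable_sqExcess [IsFiniteMeasure P] {x : Ω → ℝ} (hx : Integrable x P)
    (hx2 : Integrable (fun ω => max (x ω) 0 ^ 2) P) {y : ℝ} (hy : 0 ≤ y) :
    Integrable (fun ω => max (x ω - y) 0 ^ 2) P := by
  refine hx2.mono' ((integrable_excess hx y).aestronglyMeasurable.pow 2) (ae_of_all _ fun ω => ?_)
  rw [Real.norm_of_nonneg (by positivity)]
  exact pow_le_pow_left₀ (le_max_right _ _) (max_le_max (by linarith) le_rfl) 2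

lemma meanExcess_nonneg (x : Ω → ℝ) (y : ℝ) : 0 ≤ meanExcess P x y :=
  integral_nonneg fun _ => le_max_right _ _

lemma meanExcess_antitone [IsFiniteMeasure P] {x : Ω → ℝ} (hx : Integrable x P) :
    Antitone (meanExcess P x) := fun _ _ h =>
  integral_mono (integrable_excess hx _) (integrable_excess hx _)
    fun _ => max_le_max (by linarith) le_rfl

lemma sqExcess_nonneg (x : Ω → ℝ) (y : ℝ) : 0 ≤ sqExcess P x y :=
  integral_nonneg fun _ => by positivity

lemma sqExcess_antitoneOn [IsFiniteMeasure P] {x : Ω → ℝ} (hx : Integrable x P)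
    (hx2 : Integrable (fun ω => max (x ω) 0 ^ 2) P) :
    AntitoneOn (sqExcess P x) (Set.Ici 0) := fun _ hy _ hz h =>
  integral_mono (integrable_sqExcess hx hx2 hz) (integrable_sqExcess hx hx2 hy)
    fun _ => pow_le_pow_left₀ (le_max_right _ _) (max_le_max (by linarith) le_rfl) 2

/-- Tangent inequality at y for the convex function t ↦ ((x - t)⁺)², whose derivative is -2 (x -
t)⁺. After integration it yields the concavity of the potential on the positive half-line. -/
lemma sq_excess_sub_le (x y z : ℝ) :
    max (x - y) 0 ^ 2 - max (x - z) 0 ^ 2 ≤ 2 * (z - y) * max (x - y) 0 := by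
  rcases max_cases (x - y) 0 with ⟨h, h'⟩ | ⟨h, h'⟩ <;>
  rcases max_cases (x - z) 0 with ⟨g, g'⟩ | ⟨g, g'⟩ <;> rw [h, g] <;>
  nlinarith [sq_nonneg (z - y), sq_nonneg (x - y), sq_nonneg (x - z)]

lemma sqExcess_sub_le [IsFiniteMeasure P] {x : Ω → ℝ} (hx : Integrable x P)
    (hx2 : Integrable (fun ω => max (x ω) 0 ^ 2) P) {y z : ℝ} (hy : 0 ≤ y) (hz : 0 ≤ z) :
    sqExcess P x y - sqExcess P x z ≤ 2 * (z - y) * meanExcess P x y := by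
  unfold sqExcess meanExcess
  rw [← integral_sub (integrable_sqExcess hx hx2 hy) (integrable_sqExcess hx hx2 hz),
    ← integral_const_mul]
  exact integral_mono ((integrable_sqExcess hx hx2 hy).sub (integrable_sqExcess hx hx2 hz))
    ((integrable_excess hx y).const_mul _) fun ω => sq_excess_sub_le _ _ _

lemma four_mul_meanExcess_le [IsFiniteMeasure P] {x : Ω → ℝ} (hx : Integrable x P)
    (hx2 : Integrable (fun ω => max (x ω) 0 ^ 2) P) {L : ℝ} (hL : 0 ≤ L) :
    4 * L * meanExcess P x L ≤ ∫ ω, max (x ω) 0 ^ 2 ∂P := by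
  unfold meanExcess
  rw [← integral_const_mul]
  refine integral_mono ((integrable_excess hx L).const_mul _) hx2 fun ω => ?_
  show 4 * L * max (x ω - L) 0 ≤ max (x ω) 0 ^ 2
  rcases max_cases (x ω - L) 0 with ⟨h, h'⟩ | ⟨h, h'⟩ <;> rw [h]
  · rw [max_eq_left (by linarith)]
    -- 4L(x - L) ≤ x² is (x - 2L)² ≥ 0.
    nlinarith [sq_nonneg (x ω - 2 * L)]
  · rw [mul_zero]; positivity

lemma meanExcess_zero_le [IsProbabilityMeasure P] {x : Ω → ℝ} (hx : Integrable x P)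
    (hx2 : Integrable (fun ω => max (x ω) 0 ^ 2) P) :
    meanExcess P x 0 ≤ 1 + ∫ ω, max (x ω) 0 ^ 2 ∂P := by
  unfold meanExcess
  have h1 : (1 : ℝ) = ∫ _, (1 : ℝ) ∂P := by simp
  rw [h1, ← integral_add (integrable_const _) hx2]
  refine integral_mono (integrable_excess hx 0) ((integrable_const _).add hx2) fun ω => ?_
  show max (x ω - 0) 0 ≤ 1 + max (x ω) 0 ^ 2
  rw [sub_zero]
  nlinarith [sq_nonneg (max (x ω) 0 - 1), le_max_right (x ω) 0]

/-! ### The potential and its supermartingale property -/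

/-- The bounded part of the potential that controls the overshoot: it is concave on the positive
half-line, with slope proportional to the total mean excess, linear on `[-L, 0]` and zero below. -/
noncomputable def smoothPotential (P : Measure Ω) (X : ι → Ω → ℝ) (m L z : ℝ) : ℝ :=
  2 / m * ((∑ k, meanExcess P (X k) 0) * max (L + min z 0) 0 +
    ∑ k, (sqExcess P (X k) 0 - sqExcess P (X k) (max z 0)) / 2)

/-- A potential dominating the overshoot `z⁻` which does not increase on average as long as the
remaining budget `z` is nonnegative. -/
noncomputable def potential (P : Measure Ω) (X : ι → Ω → ℝ) (m L z : ℝ) : ℝ :=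
  max (-z) 0 + smoothPotential P X m L z

/-- Bound for the mean overshoot in terms of the number of arms, a lower bound `m` for the mean
costs and an upper bound `M` for the second moments of the positive parts of the costs. -/
noncomputable def overshootBound (K : ℕ) (m M : ℝ) : ℝ :=
  2 / m * (K * (1 + M) * (M / (2 * m)) + K * (M / 2))

variable {X : ι → Ω → ℝ} {m L : ℝ}

lemma smoothPotential_mono [IsFiniteMeasure P] (hX : ∀ k, Integrable (X k) P)
    (hX2 : ∀ k, Integrable (fun ω => max (X k ω) 0 ^ 2) P) (hm : 0 < m) :
    Monotone (smoothPotential P X m L) := by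
  intro y z hyz
  unfold smoothPotential
  have hs : 0 ≤ ∑ k, meanExcess P (X k) 0 := Finset.sum_nonneg fun k _ => meanExcess_nonneg _ _
  have hmin : min y 0 ≤ min z 0 := min_le_min hyz le_rfl
  have hmax : max y 0 ≤ max z 0 := max_le_max hyz le_rfl
  gcongr with k
  exact sqExcess_antitoneOn (hX k) (hX2 k) (Set.mem_Ici.2 (le_max_right _ _))
    (Set.mem_Ici.2 (le_max_right _ _)) hmax

lemma smoothPotential_nonneg [IsFiniteMeasure P] (hX : ∀ k, Integrable (X k) P)
    (hX2 : ∀ k, Integrable (fun ω => max (X k ω) 0 ^ 2) P) (hm : 0 < m) (z : ℝ) :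
    0 ≤ smoothPotential P X m L z := by
  unfold smoothPotential
  have hs : 0 ≤ ∑ k, meanExcess P (X k) 0 := Finset.sum_nonneg fun k _ => meanExcess_nonneg _ _
  have ht : 0 ≤ ∑ k, (sqExcess P (X k) 0 - sqExcess P (X k) (max z 0)) / 2 :=
    Finset.sum_nonneg fun k _ => div_nonneg (sub_nonneg.2 (sqExcess_antitoneOn (hX k) (hX2 k)
      (Set.mem_Ici.2 le_rfl) (Set.mem_Ici.2 (le_max_right _ _)) (le_max_right _ _))) zero_le_two
  positivity

lemma smoothPotential_le [IsProbabilityMeasure P] (hX : ∀ k, Integrable (X k) P)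
    (hX2 : ∀ k, Integrable (fun ω => max (X k ω) 0 ^ 2) P) {M : ℝ} (hm : 0 < m) (hM : 0 < M)
    (hXM : ∀ k, ∫ ω, max (X k ω) 0 ^ 2 ∂P ≤ M) (z : ℝ) :
    smoothPotential P X m (M / (2 * m)) z ≤ overshootBound (Fintype.card ι) m M := by
  unfold smoothPotential overshootBound
  have h1 : ∑ k, meanExcess P (X k) 0 ≤ Fintype.card ι * (1 + M) := by
    refine (Finset.sum_le_card_nsmul _ _ (1 + M) fun k _ => ?_).trans_eq ?_
    · exact (meanExcess_zero_le (hX k) (hX2 k)).trans (by linarith [hXM k])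
    · simp [nsmul_eq_mul, mul_add]
  have h2 : ∑ k, (sqExcess P (X k) 0 - sqExcess P (X k) (max z 0)) / 2
      ≤ Fintype.card ι * (M / 2) := by
    refine (Finset.sum_le_card_nsmul _ _ (M / 2) fun k _ => ?_).trans_eq ?_
    · have := sqExcess_nonneg (P := P) (X k) (max z 0)
      have h3 : sqExcess P (X k) 0 ≤ M := by simpa [sqExcess] using hXM k
      linarith
    · simp
  have h3 : max (M / (2 * m) + min z 0) 0 ≤ M / (2 * m) :=
    max_le (by linarith [min_le_right z 0]) (by positivity)
  have hs : 0 ≤ ∑ k, meanExcess P (X k) 0 := Finset.sum_nonneg fun k _ => meanExcess_nonneg _ _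
  gcongr

/-- Concavity on [-L, ∞): the graph lies below its tangent at y ≥ 0. Below -L the potential is
constant, whence the truncation of z. -/
lemma smoothPotential_le_add [IsFiniteMeasure P] (hX : ∀ k, Integrable (X k) P)
    (hX2 : ∀ k, Integrable (fun ω => max (X k ω) 0 ^ 2) P) (hm : 0 < m) (hL : 0 ≤ L)
    {y : ℝ} (hy : 0 ≤ y) (z : ℝ) :
    smoothPotential P X m L z ≤ smoothPotential P X m L y +
      2 / m * (∑ k, meanExcess P (X k) y) * (max z (-L) - y) := by
  unfold smoothPotential
  rw [mul_assoc, ← mul_add, max_eq_left hy, min_eq_right hy, add_zero, max_eq_left hL]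
  refine mul_le_mul_of_nonneg_left ?_ (by positivity)
  have h1 : ∑ k, (sqExcess P (X k) 0 - sqExcess P (X k) (max z 0)) / 2 ≤
      ∑ k, (sqExcess P (X k) 0 - sqExcess P (X k) y) / 2 +
        (∑ k, meanExcess P (X k) y) * (max z 0 - y) := by
    rw [Finset.sum_mul, ← Finset.sum_add_distrib]
    refine Finset.sum_le_sum fun k _ => ?_
    have := sqExcess_sub_le (hX k) (hX2 k) hy (le_max_right z 0)
    linarith
  have h2 : ∑ k, meanExcess P (X k) y ≤ ∑ k, meanExcess P (X k) 0 :=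
    Finset.sum_le_sum fun k _ => meanExcess_antitone (hX k) hy
  have h3 : max (L + min z 0) 0 - L ≤ 0 :=
    sub_nonpos.2 (max_le (by linarith [min_le_right z 0]) hL)
  -- Splits the truncated z into its part above 0, handled by `h1`, and a nonpositive part, along
  -- which the slope is the larger one at 0.
  have h4 : max z (-L) = max z 0 + (max (L + min z 0) 0 - L) := by
    rcases le_total z 0 with h | h
    · rw [max_eq_right h, min_eq_left h, zero_add, ← max_sub_sub_right]; simp
    · rw [max_eq_left h, min_eq_right h, add_zero, max_eq_left hL, max_eq_left (by linarith)]; simp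
  rw [h4]
  nlinarith [mul_le_mul_of_nonpos_right h2 h3]

lemma measurable_potential [IsFiniteMeasure P] (hX : ∀ k, Integrable (X k) P)
    (hX2 : ∀ k, Integrable (fun ω => max (X k ω) 0 ^ 2) P) (hm : 0 < m) :
    Measurable (potential P X m L) :=
  (measurable_neg.max measurable_const).add (smoothPotential_mono hX hX2 hm).measurable

lemma potential_nonneg [IsFiniteMeasure P] (hX : ∀ k, Integrable (X k) P)
    (hX2 : ∀ k, Integrable (fun ω => max (X k ω) 0 ^ 2) P) (hm : 0 < m) (z : ℝ) :
    0 ≤ potential P X m L z :=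
  add_nonneg (le_max_right _ _) (smoothPotential_nonneg hX hX2 hm z)

/-- Truncation at L costs E[(x - L)⁺] ≤ M/(4L), which is m/2 for L = M/(2m); half of the drift
survives. -/
lemma half_le_integral_min [IsFiniteMeasure P] {x : Ω → ℝ} (hx : Integrable x P)
    (hx2 : Integrable (fun ω => max (x ω) 0 ^ 2) P) {M : ℝ} (hm : 0 < m) (hM : 0 < M)
    (hxm : m ≤ ∫ ω, x ω ∂P) (hxM : ∫ ω, max (x ω) 0 ^ 2 ∂P ≤ M) :
    m / 2 ≤ ∫ ω, min (x ω) (M / (2 * m)) ∂P := by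
  have hL : 0 < M / (2 * m) := by positivity
  have h1 := (four_mul_meanExcess_le hx hx2 hL.le).trans hxM
  have h2 : ∫ ω, min (x ω) (M / (2 * m)) ∂P = ∫ ω, x ω ∂P - meanExcess P x (M / (2 * m)) := by
    unfold meanExcess
    rw [← integral_sub hx (integrable_excess hx _)]
    refine integral_congr_ae (ae_of_all _ fun ω => ?_)
    rcases le_total (x ω) (M / (2 * m)) with h | h
    · simp [h]
    · simp [h]
  have h3 : meanExcess P x (M / (2 * m)) ≤ m / 2 := by
    have e : 4 * (M / (2 * m)) * meanExcess P x (M / (2 * m)) =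
      M * (2 / m * meanExcess P x (M / (2 * m))) := by field_simp; ring
    rw [e] at h1
    have h4 : 2 / m * meanExcess P x (M / (2 * m)) ≤ 1 := by
      by_contra! h
      nlinarith
    rw [div_mul_eq_mul_div, div_le_one hm] at h4
    linarith
  linarith

/-- The mean overshoot of one pull is at most s, the total mean excess over y; the tangent of slope
(2/m)s and the truncated drift m/2 make the smooth part drop by at least s. Summing over all arms in
s makes one potential serve every arm. -/
lemma lintegral_potential_le [IsProbabilityMeasure P] (hX : ∀ k, Integrable (X k) P)
    (hX2 : ∀ k, Integrable (fun ω => max (X k ω) 0 ^ 2) P) {M : ℝ} (hm : 0 < m) (hM : 0 < M)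
    (hXm : ∀ k, m ≤ ∫ ω, X k ω ∂P) (hXM : ∀ k, ∫ ω, max (X k ω) 0 ^ 2 ∂P ≤ M)
    {y : ℝ} (hy : 0 ≤ y) (k : ι) :
    ∫⁻ ω, ENNReal.ofReal (potential P X m (M / (2 * m)) (y - X k ω)) ∂P ≤
      ENNReal.ofReal (potential P X m (M / (2 * m)) y) := by
  set L := M / (2 * m) with hLdef
  have hL : 0 < L := by positivity
  have hi1 : Integrable (fun ω => max (X k ω - y) 0) P := integrable_excess (hX k) y
  have hmeas : AEStronglyMeasurable (fun ω => smoothPotential P X m L (y - X k ω)) P :=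
    ((smoothPotential_mono hX hX2 hm).measurable.comp_aemeasurable
      (aemeasurable_const.sub (hX k).aemeasurable)).aestronglyMeasurable
  have hi2 : Integrable (fun ω => smoothPotential P X m L (y - X k ω)) P := by
    refine (integrable_const (overshootBound (Fintype.card ι) m M)).mono' hmeas
      (ae_of_all _ fun ω => ?_)
    rw [Real.norm_of_nonneg (smoothPotential_nonneg hX hX2 hm _)]
    exact smoothPotential_le hX hX2 hm hM hXM _
  have hpot : ∀ ω, potential P X m L (y - X k ω) =
      max (X k ω - y) 0 + smoothPotential P X m L (y - X k ω) := fun ω => by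
    rw [potential, neg_sub]
  have hi : Integrable (fun ω => potential P X m L (y - X k ω)) P := by
    simp_rw [hpot]; exact hi1.add hi2
  rw [← ofReal_integral_eq_lintegral_ofReal hi
    (ae_of_all _ fun ω => potential_nonneg hX hX2 hm _)]
  refine ENNReal.ofReal_le_ofReal ?_
  simp_rw [hpot]
  rw [integral_add hi1 hi2, potential, max_eq_right (by linarith : -y ≤ 0), zero_add]
  set s := ∑ k, meanExcess P (X k) y with hs
  have hs0 : 0 ≤ s := Finset.sum_nonneg fun k _ => meanExcess_nonneg _ _
  have hks : meanExcess P (X k) y ≤ s :=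
    Finset.single_le_sum (f := fun k => meanExcess P (X k) y)
      (fun k _ => meanExcess_nonneg _ _) (Finset.mem_univ k)
  have hmin : Integrable (fun ω => min (X k ω) L) P := (hX k).inf (integrable_const L)
  have h1 : ∫ ω, smoothPotential P X m L (y - X k ω) ∂P ≤
      ∫ ω, (smoothPotential P X m L y - 2 / m * s * min (X k ω) L) ∂P := by
    refine integral_mono hi2 ((integrable_const _).sub (hmin.const_mul _)) fun ω => ?_
    refine (smoothPotential_le_add hX hX2 hm hL.le hy _).trans ?_
    have h2 : max (y - X k ω) (-L) - y ≤ - min (X k ω) L := by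
      rw [sub_le_iff_le_add, max_le_iff]
      constructor
      · linarith [min_le_left (X k ω) L]
      · linarith [min_le_right (X k ω) L]
    have h3 : 0 ≤ 2 / m * s := by positivity
    show _ ≤ smoothPotential P X m L y - 2 / m * s * min (X k ω) L
    nlinarith [mul_le_mul_of_nonneg_left h2 h3]
  rw [integral_sub (integrable_const _) (hmin.const_mul _), integral_const_mul] at h1
  simp only [integral_const, probReal_univ, one_smul] at h1
  have h4 := mul_le_mul_of_nonneg_left
    (half_le_integral_min (hX k) (hX2 k) hm hM (hXm k) (hXM k)) (by positivity : 0 ≤ 2 / m * s)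
  have h5 : 2 / m * s * (m / 2) = s := by field_simp
  change meanExcess P (X k) y + _ ≤ _
  linarith

end Potential

/-- Used to integrate randomly stopped sums, written as series over all epochs. -/
lemma integrable_of_hasSum_of_summable_integral_norm {Ω : Type*} [MeasurableSpace Ω]
    {P : Measure Ω} {F : ℕ → Ω → ℝ} {f : Ω → ℝ} (hF : ∀ n, Integrable (F n) P)
    (hs : Summable fun n => ∫ ω, ‖F n ω‖ ∂P)
    (hf : ∀ᵐ ω ∂P, HasSum (fun n => F n ω) (f ω)) : Integrable f P := by
  refine ⟨aestronglyMeasurable_of_tendsto_ae atTop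
    (fun n => (integrable_finsetSum (Finset.range n) fun i _ => hF i).aestronglyMeasurable)
    (hf.mono fun ω h => h.tendsto_sum_nat), ?_⟩
  calc ∫⁻ ω, ‖f ω‖ₑ ∂P ≤ ∫⁻ ω, ∑' n, ‖F n ω‖ₑ ∂P := lintegral_mono_ae (hf.mono fun ω h => by
        rw [← h.tsum_eq]; exact enorm_tsum_le_tsum_enorm)
    _ = ∑' n, ∫⁻ ω, ‖F n ω‖ₑ ∂P := lintegral_tsum fun n => (hF n).aestronglyMeasurable.enorm
    _ = ∑' n, ENNReal.ofReal (∫ ω, ‖F n ω‖ ∂P) := tsum_congr fun n =>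
        (ofReal_integral_norm_eq_lintegral_enorm (hF n)).symm
    _ < ⊤ := by
        rw [← ENNReal.ofReal_tsum_of_nonneg (fun n => integral_nonneg fun _ => norm_nonneg _) hs]
        exact ENNReal.ofReal_lt_top

/-! ### The past, admissibility and depletion of the budget -/

namespace BudgetedBandit

variable {K : ℕ} {Ω : Type*} [mΩ : MeasurableSpace Ω] {P : Measure Ω}

/-- The cost-reward pair of epoch `p.1` and arm `p.2`. -/
def pair (𝔟 : BudgetedBandit K P) (p : ℕ × Fin K) (ω : Ω) : ℝ × ℝ :=
  (𝔟.X p.1 p.2 ω, 𝔟.R p.1 p.2 ω)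

/-- The σ-algebra of all pairs, observed or not, of the first `n` epochs. -/
@[reducible] def past (𝔟 : BudgetedBandit K P) (n : ℕ) : MeasurableSpace Ω :=
  ⨆ p ∈ {p : ℕ × Fin K | p.1 < n},
    MeasurableSpace.comap (𝔟.pair p) (inferInstance : MeasurableSpace (ℝ × ℝ))

/-- The event that the budget is not depleted in the first `n` epochs. -/
def alive (𝔟 : BudgetedBandit K P) (I : ℕ → Ω → Fin K) (B : ℝ) (n : ℕ) : Set Ω :=
  {ω | ∀ j ≤ n, 𝔟.totalCost I j ω ≤ B}

/-- The event that arm `k` is pulled, within the budget, after `n` epochs. -/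
def pulled (𝔟 : BudgetedBandit K P) (I : ℕ → Ω → Fin K) (B : ℝ) (n : ℕ) (k : Fin K) : Set Ω :=
  𝔟.alive I B n ∩ {ω | I n ω = k}

variable (𝔟 : BudgetedBandit K P) {I : ℕ → Ω → Fin K} {B : ℝ} {g : ℝ × ℝ → ℝ}

lemma measurable_pair (p : ℕ × Fin K) : Measurable (𝔟.pair p) :=
  (𝔟.measurable_X _ _).prodMk (𝔟.measurable_R _ _)

lemma past_mono {i j : ℕ} (h : i ≤ j) : 𝔟.past i ≤ 𝔟.past j :=
  biSup_mono fun _ hp => lt_of_lt_of_le hp h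

lemma past_le (n : ℕ) : 𝔟.past n ≤ mΩ :=
  iSup₂_le fun p _ => (𝔟.measurable_pair p).comap_le

lemma comap_pair_le_past {p : ℕ × Fin K} {n : ℕ} (h : p.1 < n) :
    MeasurableSpace.comap (𝔟.pair p) inferInstance ≤ 𝔟.past n :=
  le_iSup₂ (f := fun (p : ℕ × Fin K) (_ : p ∈ {p : ℕ × Fin K | p.1 < n}) =>
    MeasurableSpace.comap (𝔟.pair p) (inferInstance : MeasurableSpace (ℝ × ℝ))) p h

lemma indep_past (n : ℕ) (k : Fin K) :
    Indep (MeasurableSpace.comap (𝔟.pair (n, k)) inferInstance) (𝔟.past n) P := by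
  have h := indep_iSup_of_disjoint (fun p => (𝔟.measurable_pair p).comap_le) 𝔟.indep
    (S := {((n, k) : ℕ × Fin K)}) (T := {p : ℕ × Fin K | p.1 < n}) (by simp)
  rwa [iSup_singleton] at h

variable {𝔟}

/-- Strong induction: the choice at epoch j is determined by the history at j, so by the past, and
the observed pair is pieced together from the K pairs of that epoch. Independence can thus be used
with one filtration common to all policies. -/
lemma Admissible.history_le_past (hI : 𝔟.Admissible I) (n : ℕ) : 𝔟.history I n ≤ 𝔟.past n := by
  induction n using Nat.strong_induction_on with
  | _ n ih =>
    refine iSup₂_le fun j hj => ?_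
    rintro _ ⟨s, hs, rfl⟩
    have h : (fun ω => (𝔟.X j (I j ω) ω, 𝔟.R j (I j ω) ω)) ⁻¹' s =
        ⋃ k, {ω | I j ω = k} ∩ 𝔟.pair (j, k) ⁻¹' s := by
      ext ω; simp [pair]
    rw [h]
    exact MeasurableSet.iUnion fun k =>
      ((ih j hj).trans (𝔟.past_mono hj.le) _ (hI j k)).inter
        (𝔟.comap_pair_le_past (p := (j, k)) hj _ ⟨s, hs, rfl⟩)

lemma Admissible.measurable_totalCost (hI : 𝔟.Admissible I) (n : ℕ) :
    Measurable[𝔟.past n] (𝔟.totalCost I n) := by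
  refine Finset.measurable_fun_sum _ fun i hi => ?_
  have h : Measurable[𝔟.history I n] (fun ω => (𝔟.X i (I i ω) ω, 𝔟.R i (I i ω) ω)) :=
    Measurable.of_comap_le (le_iSup₂ (f := fun (j : ℕ) (_ : j < n) =>
      MeasurableSpace.comap (fun ω => (𝔟.X j (I j ω) ω, 𝔟.R j (I j ω) ω))
        (inferInstance : MeasurableSpace (ℝ × ℝ))) i (Finset.mem_range.1 hi))
  exact measurable_fst.comp (h.mono (hI.history_le_past n) le_rfl)

lemma Admissible.measurableSet_alive (hI : 𝔟.Admissible I) (B : ℝ) (n : ℕ) :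
    MeasurableSet[𝔟.past n] (𝔟.alive I B n) := by
  have h : 𝔟.alive I B n = ⋂ j ∈ Finset.range (n + 1), 𝔟.totalCost I j ⁻¹' Set.Iic B := by
    ext ω; simp [alive]
  rw [h]
  exact Finset.measurableSet_biInter _ fun j hj =>
    𝔟.past_mono (Nat.lt_succ_iff.1 (Finset.mem_range.1 hj)) _
      (hI.measurable_totalCost j measurableSet_Iic)

lemma Admissible.measurableSet_pulled (hI : 𝔟.Admissible I) (B : ℝ) (n : ℕ) (k : Fin K) :
    MeasurableSet[𝔟.past n] (𝔟.pulled I B n k) :=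
  (hI.measurableSet_alive B n).inter (hI.history_le_past n _ (hI n k))

variable (𝔟) in
lemma alive_antitone (I : ℕ → Ω → Fin K) (B : ℝ) : Antitone (𝔟.alive I B) :=
  fun _ _ hmn _ hω j hj => hω j (hj.trans hmn)

/-- With negative costs the total may return below B after depletion; hence `alive` constrains all j
≤ n. -/
lemma coe_lt_pulls_iff {n : ℕ} {ω : Ω} :
    (n : ℕ∞) < 𝔟.pulls I B ω ↔ ω ∈ 𝔟.alive I B n := by
  constructor
  · intro h j hj
    by_contra! hlt
    exact absurd ((iInf₂_le j hlt).trans (Nat.cast_le.2 hj)) (not_le.2 h)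
  · intro h
    have h2 : ((n + 1 : ℕ) : ℕ∞) ≤ 𝔟.pulls I B ω := by
      refine le_iInf₂ fun j hj => Nat.cast_le.2 ?_
      by_contra! hlt
      exact absurd (h j (by omega)) (not_le.2 hj)
    exact lt_of_lt_of_le (Nat.cast_lt.2 n.lt_succ_self) h2

lemma lt_totalCost_pulls {ω : Ω} (h : 𝔟.pulls I B ω < ⊤) :
    B < 𝔟.totalCost I (𝔟.pulls I B ω).toNat ω := by
  obtain ⟨N, hN⟩ := ENat.ne_top_iff_exists.1 h.ne
  rw [← hN, ENat.toNat_natCast]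
  by_contra! hle
  have h1 : ω ∈ 𝔟.alive I B N := by
    intro j hj
    rcases hj.eq_or_lt with rfl | hj
    · exact hle
    · have : (j : ℕ∞) < 𝔟.pulls I B ω := by rw [← hN]; exact Nat.cast_lt.2 hj
      exact coe_lt_pulls_iff.1 this j le_rfl
  exact absurd (coe_lt_pulls_iff.2 h1) (by rw [← hN]; exact lt_irrefl _)

lemma indicator_alive_eq_sum {β : Type*} [AddCommMonoid β] (n : ℕ) (f : Fin K → Ω → β) (ω : Ω) :
    (𝔟.alive I B n).indicator (fun ω => f (I n ω) ω) ω =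
      ∑ k, (𝔟.pulled I B n k).indicator (f k) ω := by
  by_cases h : ω ∈ 𝔟.alive I B n
  · rw [Set.indicator_of_mem h, Finset.sum_eq_single (I n ω)]
    · rw [Set.indicator_of_mem]; exact ⟨h, rfl⟩
    · intro k _ hk
      rw [Set.indicator_of_notMem]
      exact fun hc => hk hc.2.symm
    · simp
  · rw [Set.indicator_of_notMem h, Finset.sum_eq_zero]
    intro k _
    rw [Set.indicator_of_notMem]
    exact fun hc => h hc.1

/-! ### Statistics of observed pairs and independence from the past -/

/-- A statistic of the observed pair of epoch `n`, if the budget is not depleted before. -/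
noncomputable def observed (𝔟 : BudgetedBandit K P) (I : ℕ → Ω → Fin K) (B : ℝ)
    (g : ℝ × ℝ → ℝ) (n : ℕ) (ω : Ω) : ℝ :=
  ∑ k, (𝔟.pulled I B n k).indicator (fun ω => g (𝔟.pair (n, k) ω)) ω

lemma observed_eq (g : ℝ × ℝ → ℝ) (n : ℕ) (ω : Ω) :
    𝔟.observed I B g n ω =
      (𝔟.alive I B n).indicator (fun ω => g (𝔟.pair (n, I n ω) ω)) ω :=
  (indicator_alive_eq_sum n (fun k ω => g (𝔟.pair (n, k) ω)) ω).symm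

lemma hasSum_observed {ω : Ω} (h : 𝔟.pulls I B ω < ⊤) (g : ℝ × ℝ → ℝ) :
    HasSum (fun n => 𝔟.observed I B g n ω)
      (∑ n ∈ Finset.range (𝔟.pulls I B ω).toNat, g (𝔟.pair (n, I n ω) ω)) := by
  have hlt : ∀ n, ω ∈ 𝔟.alive I B n ↔ n ∈ Finset.range (𝔟.pulls I B ω).toNat := fun n => by
    rw [← coe_lt_pulls_iff, Finset.mem_range, ← Nat.cast_lt (α := ℕ∞), ENat.natCast_toNat h.ne]
  rw [Finset.sum_congr rfl fun n hn => show g (𝔟.pair (n, I n ω) ω) = 𝔟.observed I B g n ω by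
    rw [observed_eq, Set.indicator_of_mem ((hlt n).2 hn)]]
  exact hasSum_sum_of_ne_finset_zero fun n hn => by
    rw [observed_eq, Set.indicator_of_notMem (mt (hlt n).1 hn)]

variable (𝔟) in
lemma integrable_pair (hg : Measurable g) {k : Fin K}
    (hi : Integrable (fun ω => g (𝔟.pair (0, k) ω)) P) (n : ℕ) :
    Integrable (fun ω => g (𝔟.pair (n, k) ω)) P :=
  ((𝔟.identDistrib n k).comp hg).integrable_iff.2 hi

variable (𝔟) in
lemma integral_pair (hg : Measurable g) (n : ℕ) (k : Fin K) :
    ∫ ω, g (𝔟.pair (n, k) ω) ∂P = ∫ ω, g (𝔟.pair (0, k) ω) ∂P :=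
  ((𝔟.identDistrib n k).comp hg).integral_eq

/-- Conditioning on the past replaces the current pair's statistic by its mean. -/
lemma setIntegral_pair [IsProbabilityMeasure P] (hg : Measurable g) {n : ℕ} {k : Fin K}
    (hi : Integrable (fun ω => g (𝔟.pair (0, k) ω)) P) {A : Set Ω}
    (hA : MeasurableSet[𝔟.past n] A) :
    ∫ ω in A, g (𝔟.pair (n, k) ω) ∂P = P.real A * ∫ ω, g (𝔟.pair (0, k) ω) ∂P := by
  have h := condExp_indep_eq (𝔟.measurable_pair (n, k)).comap_le (𝔟.past_le n)
    (f := fun ω => g (𝔟.pair (n, k) ω))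
    (hg.comp (comap_measurable (𝔟.pair (n, k)))).stronglyMeasurable (𝔟.indep_past n k)
  rw [← setIntegral_condExp (𝔟.past_le n) (𝔟.integrable_pair hg hi n) hA,
    setIntegral_congr_ae (g := fun _ => ∫ ω, g (𝔟.pair (0, k) ω) ∂P)
      (𝔟.past_le n _ hA) (by
        filter_upwards [h] with ω hω _
        rw [hω, integral_pair 𝔟 hg])]
  simp

lemma Admissible.integrable_observed (hI : 𝔟.Admissible I) (hg : Measurable g)
    (hi : ∀ k, Integrable (fun ω => g (𝔟.pair (0, k) ω)) P) (n : ℕ) :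
    Integrable (𝔟.observed I B g n) P :=
  integrable_finsetSum _ fun k _ =>
    (𝔟.integrable_pair hg (hi k) n).indicator (𝔟.past_le n _ (hI.measurableSet_pulled B n k))

lemma Admissible.integral_observed [IsProbabilityMeasure P] (hI : 𝔟.Admissible I)
    (hg : Measurable g) (hi : ∀ k, Integrable (fun ω => g (𝔟.pair (0, k) ω)) P) (n : ℕ) :
    ∫ ω, 𝔟.observed I B g n ω ∂P =
      ∑ k, P.real (𝔟.pulled I B n k) * ∫ ω, g (𝔟.pair (0, k) ω) ∂P := by
  unfold observed
  have hm := fun k => 𝔟.past_le n _ (hI.measurableSet_pulled B n k)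
  rw [integral_finsetSum _ fun k _ => (𝔟.integrable_pair hg (hi k) n).indicator (hm k)]
  exact Finset.sum_congr rfl fun k _ => by
    rw [integral_indicator (hm k), setIntegral_pair hg (hi k) (hI.measurableSet_pulled B n k)]

lemma Admissible.sum_pulled [IsProbabilityMeasure P] (hI : 𝔟.Admissible I) (n : ℕ) :
    ∑ k, P.real (𝔟.pulled I B n k) = P.real (𝔟.alive I B n) := by
  have h := hI.integral_observed (B := B) (g := fun _ => 1) measurable_const
    (fun _ => integrable_const _) n
  simp only [observed_eq, integral_const, probReal_univ, one_smul, mul_one] at h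
  rw [← h, integral_indicator (𝔟.past_le n _ (hI.measurableSet_alive B n))]
  simp

/-! ### The stopped cost process as a supermartingale under a potential -/

/-- Stopped total cost. -/
noncomputable def stoppedCost (𝔟 : BudgetedBandit K P) (I : ℕ → Ω → Fin K) (B : ℝ)
    (n : ℕ) (ω : Ω) : ℝ :=
  ∑ i ∈ Finset.range n, 𝔟.observed I B Prod.fst i ω

lemma stoppedCost_eq {n : ℕ} {ω : Ω} (h : ω ∈ 𝔟.alive I B n) :
    𝔟.stoppedCost I B n ω = 𝔟.totalCost I n ω :=
  Finset.sum_congr rfl fun i hi => by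
    rw [observed_eq, Set.indicator_of_mem (𝔟.alive_antitone I B (Finset.mem_range.1 hi).le h)]
    rfl

lemma Admissible.measurable_observed (hI : 𝔟.Admissible I) (hg : Measurable g) {i n : ℕ}
    (hin : i < n) : Measurable[𝔟.past n] (𝔟.observed I B g i) :=
  Finset.measurable_fun_sum _ fun k _ =>
    (hg.comp ((comap_measurable (𝔟.pair (i, k))).mono
      (𝔟.comap_pair_le_past (p := (i, k)) hin) le_rfl)).indicator
      (𝔟.past_mono hin.le _ (hI.measurableSet_pulled B i k))

lemma Admissible.measurable_stoppedCost (hI : 𝔟.Admissible I) (n : ℕ) :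
    Measurable[𝔟.past n] (𝔟.stoppedCost I B n) :=
  Finset.measurable_fun_sum _ fun _ hi =>
    hI.measurable_observed measurable_fst (Finset.mem_range.1 hi)

/-- Independence makes the joint law of W and the current cost a product, so Tonelli applies. -/
lemma lintegral_past_cost [IsProbabilityMeasure P] {α : Type*} [MeasurableSpace α] {n : ℕ}
    {W : Ω → α} (hW : Measurable[𝔟.past n] W) (k : Fin K) {f : α × ℝ → ENNReal}
    (hf : Measurable f) :
    ∫⁻ ω, f (W ω, 𝔟.X n k ω) ∂P = ∫⁻ ω, ∫⁻ ω', f (W ω, 𝔟.X 0 k ω') ∂P ∂P := by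
  have hW' : Measurable W := hW.mono (𝔟.past_le n) le_rfl
  have hind : IndepFun W (𝔟.X n k) P := by
    have h1 : IndepFun W (𝔟.pair (n, k)) P :=
      indep_of_indep_of_le_left (𝔟.indep_past n k).symm hW.comap_le
    exact h1.comp measurable_id measurable_fst
  have hX : P.map (𝔟.X n k) = P.map (𝔟.X 0 k) :=
    ((𝔟.identDistrib n k).comp measurable_fst).map_eq
  rw [← lintegral_map (f := f) hf (hW'.prodMk (𝔟.measurable_X n k)),
    hind.map_prod_eq_prod_map_map hW'.aemeasurable (𝔟.measurable_X n k).aemeasurable, hX,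
    lintegral_prod _ hf.aemeasurable, lintegral_map hf.lintegral_prod_right' hW']
  exact lintegral_congr fun ω =>
    lintegral_map (hf.comp measurable_prodMk_left) (𝔟.measurable_X 0 k)

lemma Admissible.lintegral_pulled_le [IsProbabilityMeasure P] (hI : 𝔟.Admissible I)
    {φ : ℝ → ENNReal} (hφ : Measurable φ)
    (hle : ∀ y, 0 ≤ y → ∀ k, ∫⁻ ω, φ (y - 𝔟.X 0 k ω) ∂P ≤ φ y) (n : ℕ) (k : Fin K) :
    ∫⁻ ω, (𝔟.pulled I B n k).indicator
        (fun ω => φ (B - 𝔟.stoppedCost I B n ω - 𝔟.X n k ω)) ω ∂P ≤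
      ∫⁻ ω, (𝔟.pulled I B n k).indicator (fun ω => φ (B - 𝔟.stoppedCost I B n ω)) ω ∂P := by
  -- Remaining budget and pulling event form a single past-measurable variable, so that the current
  -- cost can be averaged out with both fixed.
  have hW : Measurable[𝔟.past n] (fun ω => (B - 𝔟.stoppedCost I B n ω,
      (𝔟.pulled I B n k).indicator (fun _ => (1 : ENNReal)) ω)) :=
    ((hI.measurable_stoppedCost n).const_sub B).prodMk
      (measurable_const.indicator (hI.measurableSet_pulled B n k))
  have h := lintegral_past_cost hW k (f := fun q => q.1.2 * φ (q.1.1 - q.2)) (by fun_prop)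
  have e : ∀ ω, (𝔟.pulled I B n k).indicator
      (fun ω => φ (B - 𝔟.stoppedCost I B n ω - 𝔟.X n k ω)) ω =
      (𝔟.pulled I B n k).indicator (fun _ => (1 : ENNReal)) ω *
        φ (B - 𝔟.stoppedCost I B n ω - 𝔟.X n k ω) := fun ω => by
    by_cases hω : ω ∈ 𝔟.pulled I B n k <;> simp [hω]
  simp_rw [e]
  rw [h]
  refine lintegral_mono fun ω => ?_
  by_cases hω : ω ∈ 𝔟.pulled I B n k
  · simp only [hω, Set.indicator_of_mem, one_mul]
    refine hle _ ?_ k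
    rw [stoppedCost_eq hω.1, sub_nonneg]
    exact hω.1 n le_rfl
  · simp [hω]

/-- Induction on n: after depletion the process is frozen, and before it the remaining budget is
nonnegative, so `hle` applies to whichever arm is pulled. -/
lemma Admissible.lintegral_stoppedCost_le [IsProbabilityMeasure P] (hI : 𝔟.Admissible I)
    {φ : ℝ → ENNReal} (hφ : Measurable φ)
    (hle : ∀ y, 0 ≤ y → ∀ k, ∫⁻ ω, φ (y - 𝔟.X 0 k ω) ∂P ≤ φ y) (n : ℕ) :
    ∫⁻ ω, φ (B - 𝔟.stoppedCost I B n ω) ∂P ≤ φ B := by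
  induction n with
  | zero => simp [stoppedCost]
  | succ n ih =>
    refine le_trans ?_ ih
    have hT : Measurable (𝔟.stoppedCost I B n) :=
      (hI.measurable_stoppedCost n).mono (𝔟.past_le n) le_rfl
    have hA := 𝔟.past_le n _ (hI.measurableSet_alive B n)
    have hp := fun k => 𝔟.past_le n _ (hI.measurableSet_pulled B n k)
    have hφT : Measurable fun ω => φ (B - 𝔟.stoppedCost I B n ω) := hφ.comp (hT.const_sub B)
    have hsplit : ∀ (f : Fin K → Ω → ENNReal) (f₀ : Ω → ENNReal), (∀ k, Measurable (f k)) →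
        Measurable f₀ →
        ∫⁻ ω, ((𝔟.alive I B n)ᶜ.indicator f₀ ω + ∑ k, (𝔟.pulled I B n k).indicator (f k) ω) ∂P =
        ∫⁻ ω, (𝔟.alive I B n)ᶜ.indicator f₀ ω ∂P +
          ∑ k, ∫⁻ ω, (𝔟.pulled I B n k).indicator (f k) ω ∂P := fun f f₀ hf hf₀ => by
      rw [lintegral_add_left (hf₀.indicator hA.compl), lintegral_finsetSum]
      exact fun k _ => (hf k).indicator (hp k)
    have e1 : ∀ ω, φ (B - 𝔟.stoppedCost I B (n + 1) ω) =
        (𝔟.alive I B n)ᶜ.indicator (fun ω => φ (B - 𝔟.stoppedCost I B n ω)) ω +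
        ∑ k, (𝔟.pulled I B n k).indicator
          (fun ω => φ (B - 𝔟.stoppedCost I B n ω - 𝔟.X n k ω)) ω := fun ω => by
      rw [← indicator_alive_eq_sum, stoppedCost, Finset.sum_range_succ, observed_eq]
      by_cases h : ω ∈ 𝔟.alive I B n
      · rw [Set.indicator_of_mem h, Set.indicator_of_mem h, Set.indicator_of_notMem (by simpa using h),
          zero_add, ← sub_sub]
        rfl
      · rw [Set.indicator_of_notMem h, Set.indicator_of_notMem h,
          Set.indicator_of_mem (by simpa using h), add_zero, add_zero]
        rfl
    have e2 : ∀ ω, φ (B - 𝔟.stoppedCost I B n ω) =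
        (𝔟.alive I B n)ᶜ.indicator (fun ω => φ (B - 𝔟.stoppedCost I B n ω)) ω +
        ∑ k, (𝔟.pulled I B n k).indicator (fun ω => φ (B - 𝔟.stoppedCost I B n ω)) ω :=
      fun ω => by
      rw [← indicator_alive_eq_sum n fun _ ω => φ (B - 𝔟.stoppedCost I B n ω)]
      exact (congrFun (Set.indicator_compl_add_self (𝔟.alive I B n)
        fun ω => φ (B - 𝔟.stoppedCost I B n ω)) ω).symm
    have hφX : ∀ k, Measurable fun ω => φ (B - 𝔟.stoppedCost I B n ω - 𝔟.X n k ω) :=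
      fun k => hφ.comp ((hT.const_sub B).sub (𝔟.measurable_X n k))
    rw [lintegral_congr e1, lintegral_congr e2, hsplit _ _ hφX hφT, hsplit _ _ (fun _ => hφT) hφT]
    exact add_le_add_right (Finset.sum_le_sum fun k _ => hI.lintegral_pulled_le hφ hle n k) _

-- Expected spending and Wald's identity

end BudgetedBandit

namespace BudgetedBandit

variable {K : ℕ} {Ω : Type*} [MeasurableSpace Ω] {P : Measure Ω}
  {𝔟 : BudgetedBandit K P} {I : ℕ → Ω → Fin K} {B m M : ℝ}

/-- Bounds on the costs that control the overshoot: `m` is a positive lower bound for the means,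
and `M` an upper bound for the second moments of the positive parts. -/
structure CostBounds (𝔟 : BudgetedBandit K P) (m M : ℝ) : Prop where
  pos_mean : 0 < m
  pos_sq : 0 < M
  integrable_sq : ∀ k, Integrable (fun ω => max (𝔟.X 0 k ω) 0 ^ 2) P
  le_meanCost : ∀ k, m ≤ 𝔟.meanCost k
  sq_le : ∀ k, ∫ ω, max (𝔟.X 0 k ω) 0 ^ 2 ∂P ≤ M

/-- Expected cost of the pull after `n` epochs, on the event that the budget is not depleted. -/
noncomputable def meanSpending (𝔟 : BudgetedBandit K P) (I : ℕ → Ω → Fin K) (B : ℝ) (n : ℕ) : ℝ :=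
  ∑ k, P.real (𝔟.pulled I B n k) * 𝔟.meanCost k

lemma meanSpending_nonneg (n : ℕ) : 0 ≤ 𝔟.meanSpending I B n :=
  Finset.sum_nonneg fun k _ => mul_nonneg measureReal_nonneg (𝔟.mean_pos k).le

lemma integral_reward_eq (k : Fin K) :
    ∫ ω, 𝔟.R 0 k ω ∂P = 𝔟.rewardRate k * 𝔟.meanCost k :=
  (div_mul_cancel₀ _ (𝔟.mean_pos k).ne').symm

lemma ciInf_meanCost_pos [NeZero K] : 0 < ⨅ k, 𝔟.meanCost k := by
  obtain ⟨k, hk⟩ := exists_eq_ciInf_of_finite (f := 𝔟.meanCost)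
  rw [← hk]
  exact 𝔟.mean_pos k

variable (𝔟) in
lemma admissible_staticPolicy (k : Fin K) : 𝔟.Admissible (𝔟.staticPolicy k) :=
  fun _ j => MeasurableSet.const (k = j)

variable [IsProbabilityMeasure P]

/-- The sum is the mean stopped cost, at most B plus the mean of its excess over B. The potential
dominates that excess and starts at most at the overshoot bound. With n finite, no prior knowledge
about depletion is needed. -/
lemma Admissible.sum_meanSpending_le (hI : 𝔟.Admissible I) (hb : 𝔟.CostBounds m M) (hB : 0 ≤ B)
    (n : ℕ) :
    ∑ i ∈ Finset.range n, 𝔟.meanSpending I B i ≤ B + overshootBound K m M := by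
  have hX := 𝔟.integrable_X
  set φ : ℝ → ℝ := potential P (𝔟.X 0) m (M / (2 * m)) with hφdef
  have hφ0 : ∀ y, 0 ≤ φ y := potential_nonneg hX hb.integrable_sq hb.pos_mean
  have h1 := hI.lintegral_stoppedCost_le (B := B) (φ := fun y => ENNReal.ofReal (φ y))
    (measurable_potential hX hb.integrable_sq hb.pos_mean).ennreal_ofReal
    (fun y hy k => lintegral_potential_le hX hb.integrable_sq hb.pos_mean hb.pos_sq
      hb.le_meanCost hb.sq_le hy k) n
  have h2 : φ B ≤ overshootBound K m M := by
    have := smoothPotential_le hX hb.integrable_sq hb.pos_mean hb.pos_sq hb.sq_le B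
    rw [Fintype.card_fin] at this
    rwa [hφdef, potential, max_eq_right (by linarith), zero_add]
  have hT : Integrable (𝔟.stoppedCost I B n) P :=
    integrable_finsetSum _ fun i _ => hI.integrable_observed measurable_fst hX i
  have h3 : ∫ ω, 𝔟.stoppedCost I B n ω ∂P = ∑ i ∈ Finset.range n, 𝔟.meanSpending I B i := by
    unfold stoppedCost
    rw [integral_finsetSum _ fun i _ => hI.integrable_observed measurable_fst hX i]
    exact Finset.sum_congr rfl fun i _ => hI.integral_observed measurable_fst hX i
  have hpos : Integrable (fun ω => max (𝔟.stoppedCost I B n ω - B) 0) P := integrable_excess hT B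
  have h4 : ∫ ω, max (𝔟.stoppedCost I B n ω - B) 0 ∂P ≤ overshootBound K m M := by
    rw [integral_eq_lintegral_of_nonneg_ae
      (ae_of_all _ fun ω => le_max_right (𝔟.stoppedCost I B n ω - B) 0) hpos.aestronglyMeasurable]
    refine ENNReal.toReal_le_of_le_ofReal ((hφ0 B).trans h2) ?_
    refine le_trans (lintegral_mono fun ω => ENNReal.ofReal_le_ofReal ?_)
      (h1.trans (ENNReal.ofReal_le_ofReal h2))
    rw [hφdef, potential, neg_sub]
    exact le_add_of_nonneg_right (smoothPotential_nonneg hX hb.integrable_sq hb.pos_mean _)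
  rw [← h3]
  calc ∫ ω, 𝔟.stoppedCost I B n ω ∂P ≤ ∫ ω, (B + max (𝔟.stoppedCost I B n ω - B) 0) ∂P :=
        integral_mono hT ((integrable_const B).add hpos) fun ω => by
          show _ ≤ B + max (𝔟.stoppedCost I B n ω - B) 0
          linarith [le_max_left (𝔟.stoppedCost I B n ω - B) 0]
    _ ≤ B + overshootBound K m M := by
        rw [integral_add (integrable_const B) hpos]; simpa using h4

lemma Admissible.summable_meanSpending (hI : 𝔟.Admissible I) (hb : 𝔟.CostBounds m M)
    (hB : 0 ≤ B) : Summable (𝔟.meanSpending I B) :=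
  summable_of_sum_range_le meanSpending_nonneg (hI.sum_meanSpending_le hb hB)

lemma Admissible.tsum_meanSpending_le (hI : 𝔟.Admissible I) (hb : 𝔟.CostBounds m M)
    (hB : 0 ≤ B) : ∑' n, 𝔟.meanSpending I B n ≤ B + overshootBound K m M :=
  Real.tsum_le_of_sum_range_le meanSpending_nonneg (hI.sum_meanSpending_le hb hB)

/-- Each epoch reached within the budget costs at least m on average, so bounded spending forces a
finite expected number of pulls. -/
lemma Admissible.summable_alive (hI : 𝔟.Admissible I) (hb : 𝔟.CostBounds m M)
    (hB : 0 ≤ B) : Summable fun n => P.real (𝔟.alive I B n) := by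
  refine Summable.of_nonneg_of_le (fun _ => measureReal_nonneg) (fun n => ?_)
    ((hI.summable_meanSpending hb hB).mul_left m⁻¹)
  rw [inv_mul_eq_div, le_div_iff₀ hb.pos_mean, ← hI.sum_pulled, Finset.sum_mul]
  exact Finset.sum_le_sum fun k _ =>
    mul_le_mul_of_nonneg_left (hb.le_meanCost k) measureReal_nonneg

lemma Admissible.ae_pulls_lt_top (hI : 𝔟.Admissible I) (hb : 𝔟.CostBounds m M) (hB : 0 ≤ B) :
    ∀ᵐ ω ∂P, 𝔟.pulls I B ω < ⊤ := by
  have h0 := (hI.summable_alive hb hB).tendsto_atTop_zero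
  rw [ae_iff]
  have hle : ∀ n, P.real {ω | ¬ 𝔟.pulls I B ω < ⊤} ≤ P.real (𝔟.alive I B n) := fun n =>
    measureReal_mono fun ω (hω : ¬ 𝔟.pulls I B ω < ⊤) => coe_lt_pulls_iff.1 (by
      rw [not_lt_top_iff.1 hω]; exact ENat.natCast_lt_top n)
  have h1 : P.real {ω | ¬ 𝔟.pulls I B ω < ⊤} ≤ 0 := ge_of_tendsto' h0 hle
  exact (measureReal_eq_zero_iff).1 (le_antisymm h1 measureReal_nonneg)

variable {g : ℝ × ℝ → ℝ}

lemma Admissible.summable_integral_norm_observed (hI : 𝔟.Admissible I) (hb : 𝔟.CostBounds m M)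
    (hB : 0 ≤ B) (hg : Measurable g)
    (hi : ∀ k, Integrable (fun ω => g (𝔟.pair (0, k) ω)) P) :
    Summable fun n => ∫ ω, ‖𝔟.observed I B g n ω‖ ∂P := by
  have hn : ∀ n, ∫ ω, ‖𝔟.observed I B g n ω‖ ∂P =
      ∑ k, P.real (𝔟.pulled I B n k) * ∫ ω, ‖g (𝔟.pair (0, k) ω)‖ ∂P := fun n => by
    rw [← hI.integral_observed (g := fun q => ‖g q‖) hg.norm (fun k => (hi k).norm) n]
    refine integral_congr_ae (ae_of_all _ fun ω => ?_)
    simp only [observed_eq, norm_indicator_eq_indicator_norm]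
  simp_rw [hn]
  refine Summable.of_nonneg_of_le
    (fun n => Finset.sum_nonneg fun k _ => mul_nonneg measureReal_nonneg
      (integral_nonneg fun _ => norm_nonneg _)) (fun n => ?_)
    ((hI.summable_alive hb hB).mul_right (∑ k, ∫ ω, ‖g (𝔟.pair (0, k) ω)‖ ∂P))
  rw [← hI.sum_pulled, Finset.sum_mul]
  refine Finset.sum_le_sum fun k _ => mul_le_mul_of_nonneg_left ?_ measureReal_nonneg
  exact Finset.single_le_sum (f := fun k => ∫ ω, ‖g (𝔟.pair (0, k) ω)‖ ∂P)
    (fun _ _ => integral_nonneg fun _ => norm_nonneg _) (Finset.mem_univ k)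

/-- Wald's identity. -/
lemma Admissible.hasSum_wald (hI : 𝔟.Admissible I) (hb : 𝔟.CostBounds m M)
    (hB : 0 ≤ B) (hg : Measurable g)
    (hi : ∀ k, Integrable (fun ω => g (𝔟.pair (0, k) ω)) P) :
    HasSum (fun n => ∑ k, P.real (𝔟.pulled I B n k) * ∫ ω, g (𝔟.pair (0, k) ω) ∂P)
      (∫ ω, ∑ n ∈ Finset.range (𝔟.pulls I B ω).toNat, g (𝔟.pair (n, I n ω) ω) ∂P) := by
  have h := hasSum_integral_of_summable_integral_norm
    (hI.integrable_observed (B := B) hg hi) (hI.summable_integral_norm_observed hb hB hg hi)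
  simp_rw [hI.integral_observed hg hi] at h
  rwa [integral_congr_ae ((hI.ae_pulls_lt_top hb hB).mono fun ω hω => (hasSum_observed hω g).tsum_eq)] at h

lemma Admissible.integrable_sum_pair (hI : 𝔟.Admissible I) (hb : 𝔟.CostBounds m M)
    (hB : 0 ≤ B) (hg : Measurable g)
    (hi : ∀ k, Integrable (fun ω => g (𝔟.pair (0, k) ω)) P) :
    Integrable (fun ω => ∑ n ∈ Finset.range (𝔟.pulls I B ω).toNat, g (𝔟.pair (n, I n ω) ω)) P :=
  integrable_of_hasSum_of_summable_integral_norm (hI.integrable_observed (B := B) hg hi)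
    (hI.summable_integral_norm_observed hb hB hg hi)
    ((hI.ae_pulls_lt_top hb hB).mono fun _ hω => hasSum_observed hω g)

/-- Wald's identity for the costs, combined with S_N > B. -/
lemma Admissible.le_tsum_meanSpending (hI : 𝔟.Admissible I) (hb : 𝔟.CostBounds m M)
    (hB : 0 ≤ B) : B ≤ ∑' n, 𝔟.meanSpending I B n := by
  have h := (hI.hasSum_wald hb hB measurable_fst 𝔟.integrable_X).tsum_eq
  have h' : ∑' n, 𝔟.meanSpending I B n = _ := h
  rw [h']
  calc B = ∫ _, B ∂P := by simp
    _ ≤ _ := integral_mono_ae (integrable_const _)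
      (hI.integrable_sum_pair hb hB measurable_fst 𝔟.integrable_X)
      ((hI.ae_pulls_lt_top hb hB).mono fun ω hω => (lt_totalCost_pulls hω).le)

lemma Admissible.integrable_reward (hI : 𝔟.Admissible I) (hb : 𝔟.CostBounds m M)
    (hB : 0 ≤ B) : Integrable (𝔟.reward I B) P :=
  hI.integrable_sum_pair hb hB measurable_snd 𝔟.integrable_R

/-! ### Comparison with the static policy -/

lemma Admissible.expReward_le (hI : 𝔟.Admissible I) (hb : 𝔟.CostBounds m M) (hB : 0 ≤ B) {r : ℝ}
    (hr : ∀ k, 𝔟.rewardRate k ≤ r) : 𝔟.expReward I B ≤ r * ∑' n, 𝔟.meanSpending I B n := by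
  have h := hI.hasSum_wald hb hB measurable_snd 𝔟.integrable_R
  refine hasSum_le (fun n => ?_) h ((hI.summable_meanSpending hb hB).hasSum.mul_left r)
  rw [meanSpending, Finset.mul_sum]
  refine Finset.sum_le_sum fun k _ => ?_
  have e : ∫ ω, (𝔟.pair (0, k) ω).2 ∂P = 𝔟.rewardRate k * 𝔟.meanCost k := integral_reward_eq k
  rw [e, mul_left_comm]
  exact mul_le_mul_of_nonneg_right (hr k) (mul_nonneg measureReal_nonneg (𝔟.mean_pos k).le)

lemma expReward_staticPolicy (hb : 𝔟.CostBounds m M) (hB : 0 ≤ B) (k : Fin K) :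
    𝔟.expReward (𝔟.staticPolicy k) B =
      𝔟.rewardRate k * ∑' n, 𝔟.meanSpending (𝔟.staticPolicy k) B n := by
  have hI := 𝔟.admissible_staticPolicy k
  have h := hI.hasSum_wald hb hB measurable_snd 𝔟.integrable_R
  refine h.unique (((hI.summable_meanSpending hb hB).hasSum.mul_left _).congr_fun fun n => ?_)
  rw [meanSpending, Finset.mul_sum]
  refine Finset.sum_congr rfl fun j _ => ?_
  have e : ∫ ω, (𝔟.pair (0, j) ω).2 ∂P = 𝔟.rewardRate j * 𝔟.meanCost j := integral_reward_eq j
  rw [e]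
  by_cases hj : k = j
  · subst hj; ring
  · have h0 : 𝔟.pulled (𝔟.staticPolicy k) B n j = ∅ :=
      Set.eq_empty_of_forall_notMem fun ω hω => hj hω.2
    simp [h0]

/-- Both total mean spendings lie between B and B plus the overshoot bound, so they differ by at
most that bound. The absolute value covers negative reward rates. -/
lemma Admissible.expReward_sub_le (hI : 𝔟.Admissible I) (hb : 𝔟.CostBounds m M) (hB : 0 ≤ B)
    {k : Fin K} (hk : ∀ j, 𝔟.rewardRate j ≤ 𝔟.rewardRate k) :
    𝔟.expReward I B - 𝔟.expReward (𝔟.staticPolicy k) B ≤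
      |𝔟.rewardRate k| * overshootBound K m M := by
  have h1 := hI.expReward_le hb hB hk
  have hs := 𝔟.admissible_staticPolicy k
  rw [expReward_staticPolicy hb hB]
  have a1 := hI.le_tsum_meanSpending hb hB
  have a2 := hI.tsum_meanSpending_le hb hB
  have b1 := hs.le_tsum_meanSpending hb hB
  have b2 := hs.tsum_meanSpending_le hb hB
  refine le_trans (sub_le_sub_right h1 _) ?_
  rw [← mul_sub]
  refine (le_abs_self _).trans ?_
  rw [abs_mul]
  refine mul_le_mul_of_nonneg_left (abs_le.2 ⟨?_, ?_⟩) (abs_nonneg _) <;> linarith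

lemma expReward_le_optReward (hb : 𝔟.CostBounds m M) (hB : 0 ≤ B)
    {k : Fin K} (hk : ∀ j, 𝔟.rewardRate j ≤ 𝔟.rewardRate k) :
    𝔟.expReward (𝔟.staticPolicy k) B ≤ 𝔟.optReward B := by
  -- The constant gap also provides the upper bound without which the real supremum would be a
  -- default value.
  refine le_csSup ⟨𝔟.expReward (𝔟.staticPolicy k) B + |𝔟.rewardRate k| * overshootBound K m M, ?_⟩
    ⟨_, 𝔟.admissible_staticPolicy k, rfl⟩
  rintro _ ⟨I, hI, rfl⟩
  linarith [hI.expReward_sub_le hb hB hk]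

lemma optReward_sub_le (hb : 𝔟.CostBounds m M) (hB : 0 ≤ B)
    {k : Fin K} (hk : ∀ j, 𝔟.rewardRate j ≤ 𝔟.rewardRate k) :
    𝔟.optReward B - 𝔟.expReward (𝔟.staticPolicy k) B ≤
      |𝔟.rewardRate k| * overshootBound K m M := by
  rw [sub_le_iff_le_add]
  refine csSup_le ⟨_, _, 𝔟.admissible_staticPolicy k, rfl⟩ ?_
  rintro _ ⟨I, hI, rfl⟩
  linarith [hI.expReward_sub_le hb hB hk]

/-! ### Asymptotic optimality -/

lemma tendsto_optReward_sub_div (hb : 𝔟.CostBounds m M)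
    {k : Fin K} (hk : ∀ j, 𝔟.rewardRate j ≤ 𝔟.rewardRate k) :
    Tendsto (fun B => (𝔟.optReward B - 𝔟.expReward (𝔟.staticPolicy k) B) / B) atTop (𝓝 0) := by
  refine squeeze_zero' ?_ ?_
    (tendsto_const_nhds.div_atTop tendsto_id : Tendsto
      (fun B : ℝ => |𝔟.rewardRate k| * overshootBound K m M / B) atTop (𝓝 0))
  · filter_upwards [eventually_ge_atTop 0] with B hB
    exact div_nonneg (sub_nonneg.2 (expReward_le_optReward hb hB hk)) hB
  · filter_upwards [eventually_ge_atTop 0] with B hB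
    exact div_le_div_of_nonneg_right (optReward_sub_le hb hB hk) hB

lemma tendsto_expReward_staticPolicy_div (hb : 𝔟.CostBounds m M) (k : Fin K) :
    Tendsto (fun B => 𝔟.expReward (𝔟.staticPolicy k) B / B) atTop (𝓝 (𝔟.rewardRate k)) := by
  have hs := 𝔟.admissible_staticPolicy k
  have h : Tendsto (fun B => (∑' n, 𝔟.meanSpending (𝔟.staticPolicy k) B n) / B) atTop (𝓝 1) := by
    have hu : Tendsto (fun B : ℝ => 1 + overshootBound K m M / B) atTop (𝓝 1) := by
      simpa using (tendsto_const_nhds (x := (1 : ℝ))).add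
        (tendsto_const_nhds.div_atTop tendsto_id : Tendsto
          (fun B : ℝ => overshootBound K m M / B) atTop (𝓝 0))
    refine tendsto_of_tendsto_of_tendsto_of_le_of_le' tendsto_const_nhds hu ?_ ?_
    · filter_upwards [eventually_gt_atTop 0] with B hB
      rw [le_div_iff₀ hB, one_mul]
      exact hs.le_tsum_meanSpending hb hB.le
    · filter_upwards [eventually_gt_atTop 0] with B hB
      rw [div_le_iff₀ hB, add_mul, div_mul_cancel₀ _ hB.ne', one_mul]
      exact hs.tsum_meanSpending_le hb hB.le
  have h2 := h.const_mul (𝔟.rewardRate k)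
  rw [mul_one] at h2
  refine h2.congr' ?_
  filter_upwards [eventually_ge_atTop 0] with B hB
  rw [expReward_staticPolicy hb hB, mul_div_assoc]

/-- Divided by B, numerator and denominator both tend to the nonzero rate of arm k. -/
lemma tendsto_expReward_div_optReward (hb : 𝔟.CostBounds m M)
    {k : Fin K} (hk : ∀ j, 𝔟.rewardRate j ≤ 𝔟.rewardRate k) (hr : 𝔟.rewardRate k ≠ 0) :
    Tendsto (fun B => 𝔟.expReward (𝔟.staticPolicy k) B / 𝔟.optReward B) atTop (𝓝 1) := by
  have h1 := tendsto_expReward_staticPolicy_div hb k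
  have h2 := h1.add (tendsto_optReward_sub_div hb hk)
  rw [add_zero] at h2
  have h3 := h1.div h2 hr
  rw [div_self hr] at h3
  refine h3.congr' ?_
  filter_upwards [eventually_gt_atTop 0] with B hB
  simp only [Pi.div_apply]
  rw [← add_div, add_sub_cancel, div_div_div_cancel_right₀ hB.ne']

/-! ### Cost bounds from the moment assumptions -/

lemma MomentCondition.integrable_sq (h : 𝔟.MomentCondition) (k : Fin K) :
    Integrable (fun ω => max (𝔟.X 0 k ω) 0 ^ 2) P := by
  obtain ⟨γ, hγ, h⟩ := h
  refine ((integrable_const (1 : ℝ)).add (h k)).mono'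
    (((𝔟.measurable_X 0 k).max measurable_const).pow_const 2).aestronglyMeasurable
    (ae_of_all _ fun ω => ?_)
  rw [Real.norm_of_nonneg (by positivity)]
  show max (𝔟.X 0 k ω) 0 ^ 2 ≤ 1 + max (𝔟.X 0 k ω) 0 ^ (2 + γ)
  have h0 : 0 ≤ max (𝔟.X 0 k ω) 0 := le_max_right _ _
  rcases le_total (max (𝔟.X 0 k ω) 0) 1 with h1 | h1
  · have := pow_le_one₀ (n := 2) h0 h1
    have := Real.rpow_nonneg h0 (2 + γ)
    linarith
  · have := Real.rpow_le_rpow_of_exponent_le h1 (by linarith : (2 : ℝ) ≤ 2 + γ)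
    rw [Real.rpow_two] at this
    linarith

lemma MomentCondition.exists_costBounds [NeZero K] (h : 𝔟.MomentCondition) :
    ∃ m M, 𝔟.CostBounds m M := by
  -- The sum dominates every second moment, and the summand 1 makes the bound positive.
  refine ⟨⨅ k, 𝔟.meanCost k, 1 + ∑ k, ∫ ω, max (𝔟.X 0 k ω) 0 ^ 2 ∂P, ciInf_meanCost_pos, ?_,
    h.integrable_sq, fun k => ciInf_le (Set.finite_range _).bddBelow k, fun k => ?_⟩
  · have : 0 ≤ ∑ k, ∫ ω, max (𝔟.X 0 k ω) 0 ^ 2 ∂P :=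
      Finset.sum_nonneg fun k _ => integral_nonneg fun _ => by positivity
    linarith
  · have := Finset.single_le_sum (f := fun k => ∫ ω, max (𝔟.X 0 k ω) 0 ^ 2 ∂P)
      (fun k _ => integral_nonneg fun _ => by positivity) (Finset.mem_univ k)
    exact this.trans (le_add_of_nonneg_left zero_le_one)

/-- E[(X⁺)²] ≤ E[X²] = Var X + (E X)². This is the origin of v + b² in the universal function G. -/
lemma FiniteVariance.costBounds [NeZero K] (h : 𝔟.FiniteVariance) :
    𝔟.CostBounds (⨅ k, 𝔟.meanCost k)
      ((⨆ k, 𝔟.varCost k) + (⨆ k, 𝔟.meanCost k) ^ 2) := by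
  have hmax : ∀ k, 𝔟.meanCost k ≤ ⨆ k, 𝔟.meanCost k :=
    fun k => le_ciSup (Set.finite_range _).bddAbove k
  have hvar : ∀ k, 𝔟.varCost k ≤ ⨆ k, 𝔟.varCost k :=
    fun k => le_ciSup (Set.finite_range _).bddAbove k
  have hsq : ∀ k ω, max (𝔟.X 0 k ω) 0 ^ 2 ≤ 𝔟.X 0 k ω ^ 2 := fun k ω => by
    rcases max_cases (𝔟.X 0 k ω) 0 with ⟨h, -⟩ | ⟨h, -⟩ <;> rw [h]
    simpa using sq_nonneg (𝔟.X 0 k ω)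
  have hi : ∀ k, Integrable (fun ω => max (𝔟.X 0 k ω) 0 ^ 2) P := fun k =>
    (h k).integrable_sq.mono'
      (((𝔟.measurable_X 0 k).max measurable_const).pow_const 2).aestronglyMeasurable
      (ae_of_all _ fun ω => by
        rw [Real.norm_of_nonneg (by positivity)]
        exact hsq k ω)
  refine ⟨ciInf_meanCost_pos, ?_, hi, fun k => ciInf_le (Set.finite_range _).bddBelow k,
    fun k => ?_⟩
  · have h1 : 0 < 𝔟.meanCost 0 := 𝔟.mean_pos 0
    have h2 : 0 ≤ 𝔟.varCost 0 := variance_nonneg _ _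
    have := hmax 0
    have := hvar 0
    have : 0 < (⨆ k, 𝔟.meanCost k) ^ 2 := by apply pow_pos; linarith
    linarith
  · have h1 := integral_mono (hi k) (h k).integrable_sq (hsq k)
    have h2 : 𝔟.varCost k = ∫ ω, 𝔟.X 0 k ω ^ 2 ∂P - 𝔟.meanCost k ^ 2 := variance_eq_sub (h k)
    have h3 : 𝔟.meanCost k ^ 2 ≤ (⨆ k, 𝔟.meanCost k) ^ 2 :=
      pow_le_pow_left₀ (𝔟.mean_pos k).le (hmax k) 2
    linarith [hvar k]

end BudgetedBandit

theorem proposition1 :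
    ∃ G : ℕ → ℝ → ℝ → ℝ → ℝ,
      ∀ (K : ℕ) (Ω : Type*) [MeasurableSpace Ω] (P : Measure Ω) [IsProbabilityMeasure P]
        (𝔟 : BudgetedBandit K P), 𝔟.MomentCondition →
      ∀ kstar : Fin K, (∀ k, 𝔟.rewardRate k ≤ 𝔟.rewardRate kstar) →
        -- the number of pulls is a.s. finite and the cumulative reward has an expectation
        (∀ I, 𝔟.Admissible I → ∀ B : ℝ, 0 < B →
          (∀ᵐ ω ∂P, 𝔟.pulls I B ω < ⊤) ∧ Integrable (𝔟.reward I B) P) ∧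
        -- the static policy is itself admissible
        𝔟.Admissible (𝔟.staticPolicy kstar) ∧
        -- the optimality gap is at most a constant
        (∃ Gstar : ℝ,
          (𝔟.FiniteVariance →
            Gstar = |𝔟.rewardRate kstar| *
              G K (⨅ k, 𝔟.meanCost k) (⨆ k, 𝔟.meanCost k) (⨆ k, 𝔟.varCost k)) ∧
          ∀ B : ℝ, 0 < B → ∀ I, 𝔟.Admissible I →
            𝔟.expReward I B - 𝔟.expReward (𝔟.staticPolicy kstar) B ≤ Gstar) ∧
        -- asymptotic optimality
        Tendsto (fun B : ℝ =>
          (𝔟.optReward B - 𝔟.expReward (𝔟.staticPolicy kstar) B) / B) atTop (𝓝 0) ∧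
        (𝔟.rewardRate kstar ≠ 0 →
          Tendsto (fun B : ℝ =>
            𝔟.expReward (𝔟.staticPolicy kstar) B / 𝔟.optReward B) atTop (𝓝 1)) := by

  refine ⟨fun K m b v => overshootBound K m (v + b ^ 2), ?_⟩
  intro K Ω _ P _ 𝔟 hmom kstar hk
  have : NeZero K := ⟨fun h => (h ▸ kstar).elim0⟩
  obtain ⟨m, M, hb⟩ := hmom.exists_costBounds
  refine ⟨fun I hI B hB => ⟨hI.ae_pulls_lt_top hb hB.le, hI.integrable_reward hb hB.le⟩,
    𝔟.admissible_staticPolicy kstar, ?_, BudgetedBandit.tendsto_optReward_sub_div hb hk,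
    BudgetedBandit.tendsto_expReward_div_optReward hb hk⟩
  -- Without finite variance the formula for the constant is not required, and the bounds from the
  -- moment condition are used instead.
  by_cases hv : 𝔟.FiniteVariance
  · exact ⟨_, fun _ => rfl, fun B hB I hI => hI.expReward_sub_le hv.costBounds hB.le hk⟩
  · exact ⟨_, fun h => absurd h hv, fun B hB I hI => hI.expReward_sub_le hb hB.le hk⟩
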